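/- Let $V$ be a finite set. Let $G_0$ be either a directed graph on $V$ without multiple edges (loops are allowed; they can be excluded by taking $G_0$ loopless and putting all loops into $\mathcal F$ below) or an undirected simple graph on $V$. Write $uv$ for the edge from $u$ to $v$ (in the undirected case $uv=vu$), and let $\mathcal F$ be an arbitrary set of possible edges. Let $\mathcal G$ be the set of all graphs $G$ on $V$ of the same kind (directed, or undirected simple) with the same degree sequence as $G_0$ (in- and out-degree of every vertex in the directed case, degree of every vertex in the undirected case) and with $E(G)\cap\mathcal F=E(G_0)\cap\mathcal F$. Let $\tilde{\mathcal F}$ be the set of pairs $uv$ that are edges of every $G\in\mathcal G$ or of no $G\in\mathcal G$. For a graph $G$ on $V$ of this kind and $u\in V$ put $$N_G(u)=\{v\in V: vu\in E(G),\ vu\notin\tilde{\mathcal F}\},\qquad M_G(u)=\{v\in V: uv\notin E(G),\ uv\notin\tilde{\mathcal F}\}.$$ One iteration of the Unweighted Graph Sampler started from $G\in\mathcal G$ is the following. If $N_G(v)=\emptyset$ for all $v\in V$, return $G$. Otherwise set $W_{-1}=*$ (a symbol that is not a vertex), draw $W_0$ uniformly from $\{v\in V:N_G(v)\ne\emptyset\}$,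 set $n=0$, and repeat: draw $W_{n+1}$ uniformly from $N_G(W_n)\setminus\{W_{n-1}\}$; draw $W_{n+2}$ uniformly from $M_G(W_{n+1})$; remove the edge $W_{n+1}W_n$ from $G$ and add the edge $W_{n+1}W_{n+2}$; increase $n$ by $2$; until $W_n=W_0$. Then return the current graph $G$. For $G,H\in\mathcal G$ let $Q(G,H)$ be the probability that one iteration started from $G$ terminates and returns $H$. Then the Markov chain with transition matrix $Q$ is ergodic with respect to the uniform distribution $\pi$ on $\mathcal G$, in the following sense: $Q$ is a stochastic matrix on $\mathcal G$ (so an iteration almost surely terminates and returns an element of $\mathcal G$), $\pi$ is stationary for $Q$, $Q$ is irreducible, and for every initial state $G\in\mathcal G$ and every $H\in\mathcal G$, $$\lim_{n\to\infty}\frac1n\sum_{k=0}^{n-1}Q^k(G,H)=\pi(H)=\frac1{|\mathcal G|}.$$ -/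

import Mathlib

open scoped ENNReal

/-! ### Ergodic finite Markov chains -/

/-- The finite Markov chain with transition matrix `P` on `S` is *ergodic with respect to* `π`:
`P` is a transition matrix, `π` is a stationary probability distribution, the chain is irreducible
(every state is reached from every state with positive probability), and, whatever the initial
state `x`, the time averages `n⁻¹ ∑_{k < n} Pᵏ(x, ·)` converge to `π`.
(Aperiodicity is not part of this notion.) -/
structure IsErgodicChain {S : Type*} [Fintype S] [DecidableEq S] (P : Matrix S S ℝ) (π : S → ℝ) :
    Prop where
  stochastic : P ∈ Matrix.rowStochastic ℝ S
  prob : π ∈ stdSimplex ℝ S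
  stationary : Matrix.vecMul π P = π
  irreducible : P.IsIrreducible
  average : ∀ x y : S, Filter.Tendsto
    (fun n : ℕ => (n : ℝ)⁻¹ * ∑ k ∈ Finset.range n, (P ^ k) x y) Filter.atTop (nhds (π y))

/-- The uniform distribution on a finite set. -/
noncomputable def uniformDist (S : Type*) [Fintype S] : S → ℝ := fun _ => (Fintype.card S : ℝ)⁻¹

/-! ### Graphs on a fixed vertex set whose edges can be edited

The algorithm is the same for directed and for undirected graphs; the two instances below are the
only ones used. -/

/-- A type `X` of graphs on the vertex set `V`, with the operations `E(G) ∖ {uv}`, `E(G) ∪ {uv}`. -/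
class EditableGraph (X : Type*) (V : outParam Type*) where
  /-- `uv ∈ E(G)` -/
  HasEdge : X → V → V → Prop
  /-- `E(G) ∖ {uv}` -/
  removeEdge : X → V → V → X
  /-- `E(G) ∪ {uv}` -/
  addEdge : X → V → V → X

/-- Directed graphs without multiple edges (loops are allowed). -/
instance instEditableDigraph (V : Type*) : EditableGraph (Digraph V) V where
  HasEdge G u v := G.Adj u v
  removeEdge G u v := ⟨fun a b => G.Adj a b ∧ ¬(a = u ∧ b = v)⟩
  addEdge G u v := ⟨fun a b => G.Adj a b ∨ (a = u ∧ b = v)⟩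

/-- Undirected simple graphs. -/
instance instEditableSimpleGraph (V : Type*) : EditableGraph (SimpleGraph V) V where
  HasEdge G u v := G.Adj u v
  removeEdge G u v := G.deleteEdges {s(u, v)}
  addEdge G u v := G ⊔ SimpleGraph.edge u v

/-! ### The state spaces -/

/-- The edge set of a digraph. -/
def Digraph.edges {V : Type*} (G : Digraph V) : Set (V × V) := {e | G.Adj e.1 e.2}

/-- The number of edges of `G` that end in `v`. -/
noncomputable def Digraph.inDeg {V : Type*} (G : Digraph V) (v : V) : ℕ :=
  {u | G.Adj u v}.ncard

/-- The number of edges of `G` that start in `v`. -/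
noncomputable def Digraph.outDeg {V : Type*} (G : Digraph V) (v : V) : ℕ :=
  {u | G.Adj v u}.ncard

/-- The digraphs with the in- and out-degrees of `G₀` that agree with `G₀` on `F`. -/
def directedClass {V : Type*} (G₀ : Digraph V) (F : Set (V × V)) : Set (Digraph V) :=
  {G | (∀ v, G.inDeg v = G₀.inDeg v ∧ G.outDeg v = G₀.outDeg v) ∧ G.edges ∩ F = G₀.edges ∩ F}

open Classical in
/-- The simple graphs with the degrees of `G₀` that agree with `G₀` on `F`. -/
def undirectedClass {V : Type*} [Fintype V] (G₀ : SimpleGraph V) (F : Set (Sym2 V)) :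
    Set (SimpleGraph V) :=
  {G | (∀ v, G.degree v = G₀.degree v) ∧ G.edgeSet ∩ F = G₀.edgeSet ∩ F}

/-! ### One iteration of the sampler -/

namespace UGS

open EditableGraph

/-- The probability of the point `b` under the uniform distribution on `s`
(the zero measure if `s` is empty: nothing can then be sampled). -/
noncomputable def unif {β : Type*} [DecidableEq β] (s : Finset β) (b : β) : ℝ≥0∞ :=
  if b ∈ s then (s.card : ℝ≥0∞)⁻¹ else 0

section

variable {V X : Type*} [Fintype V] [EditableGraph X V]

/-- `uv` is known: it is an edge of all the graphs in `𝒢`, or of none of them. -/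
def Known (𝒢 : Set X) (u v : V) : Prop :=
  (∀ G ∈ 𝒢, HasEdge G u v) ∨ (∀ G ∈ 𝒢, ¬ HasEdge G u v)

open Classical in
/-- `N_G(u)`: the vertices `v` such that `vu` is an edge of `G` and is not known. -/
noncomputable def inNbrs (𝒢 : Set X) (G : X) (u : V) : Finset V :=
  {v | HasEdge G v u ∧ ¬ Known 𝒢 v u}

open Classical in
/-- `M_G(u)`: the vertices `v` such that `uv` is not an edge of `G` and is not known. -/
noncomputable def nonOutNbrs (𝒢 : Set X) (G : X) (u : V) : Finset V :=
  {v | ¬ HasEdge G u v ∧ ¬ Known 𝒢 u v}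

open Classical in
/-- `N_G(w) ∖ {p}`, where `p = none` stands for the symbol `*`, which is not a vertex. -/
noncomputable def inNbrsAvoid (𝒢 : Set X) (G : X) (p : Option V) (w : V) : Finset V :=
  {v ∈ inNbrs 𝒢 G w | some v ≠ p}

open Classical in
/-- The vertices from which an iteration may start. -/
noncomputable def startSet (𝒢 : Set X) (G : X) : Finset V :=
  {v | (inNbrs 𝒢 G v).Nonempty}

/-- Replace the edge `ab` by the edge `ac`. -/
def swapEdge (G : X) (a b c : V) : X := addEdge (removeEdge G a b) a c

open Classical in
/-- `exitProb 𝒢 w₀ k G p w H` is the probability that the repeat-loop, entered with current graph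
`G`, `W₀ = w₀`, `W_{n-1} = p` and `W_n = w`, stops after exactly `k` passes and returns `H`.
In one pass `W_{n+1} = a` is drawn from `N_G(w) ∖ {p}`, then `W_{n+2} = b` from `M_G(a)`, then the
edge `aw` is replaced by `ab`; the loop stops if `b = w₀`. -/
noncomputable def exitProb (𝒢 : Set X) (w₀ : V) : ℕ → X → Option V → V → X → ℝ≥0∞
  | 0, _, _, _, _ => 0
  | k + 1, G, p, w, H =>
      ∑ a : V, ∑ b : V, unif (inNbrsAvoid 𝒢 G p w) a * unif (nonOutNbrs 𝒢 G a) b *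
        (if b = w₀ then
          (if k = 0 ∧ swapEdge G a w b = H then 1 else 0)
        else exitProb 𝒢 w₀ k (swapEdge G a w b) (some a) b H)

open Classical in
/-- The probability that one iteration, started from `G`, terminates and returns `H`. If there is
no vertex to start from, the iteration does nothing. -/
noncomputable def iterProb (𝒢 : Set X) (G H : X) : ℝ≥0∞ :=
  if (startSet 𝒢 G).Nonempty then
    ∑ w₀ : V, unif (startSet 𝒢 G) w₀ * ∑' k : ℕ, exitProb 𝒢 w₀ k G none w₀ H
  else if G = H then 1 else 0

/-- The transition matrix of the sampler, on the state space `𝒢`. -/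
noncomputable def transition (𝒢 : Set X) : Matrix 𝒢 𝒢 ℝ :=
  Matrix.of fun G H => (iterProb 𝒢 (G : X) (H : X)).toReal

end

end UGS

/-! The transition matrix is symmetric, stochastic and has all states communicating. Symmetry makes
the uniform distribution stationary, and the averages converge by the mean ergodic theorem for
finite irreducible chains (`tendsto_average_pow`), which needs no aperiodicity.

All three properties come from one invariant, axiomatised in `IsSwapSystem` so that directed and
undirected graphs share the argument: inside the loop the current graph has the degrees of the
class, except that one edge is missing at `w₀` and there is one too many at the current vertex `w`;
known pairs are never touched.

Symmetry is reversal of trajectories. The number of admissible tails at `w` depends on `w` alone,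
because the excluded previous tail offsets the surplus edge (`card_inNbrsAvoid`), and replacing `aw`
by `ab` does not change the number of admissible heads at `a` (`card_nonOutNbrs_swap`). So a
trajectory and its reversal have the same weight; algebraically, the exit probabilities are entries
of a palindromic product of symmetric matrices (`dotProduct_exitVec_comm`).

Communication and termination both use `exists_exits`: steered towards a fixed graph `H` of the
class, the loop can trade an edge outside `H` for one of `H` at every pass, so it closes up nearer
to `H`. Hence any state can approach any other, and every loop state has a way out. Since there are
finitely many loop states, a minimum principle for the stopping probability (`not_exits`) then
forces it to be 1. -/

/-! ### Finite Markov chains -/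

section Markov

open Matrix Finset

variable {S : Type*} [Fintype S] [DecidableEq S] {P : Matrix S S ℝ}

/-- The hypothesis allows `k = 0`, whereas irreducibility asks for positive powers; a row summing to
1 has a positive entry, which supplies one extra step in front. -/
theorem isIrreducible_of_rowStochastic (hP : P ∈ rowStochastic ℝ S)
    (h : ∀ i j, ∃ k, 0 < (P ^ k) i j) : P.IsIrreducible := by
  rw [isIrreducible_iff_exists_pow_pos hP.1]
  intro i j
  obtain ⟨l, hl⟩ : ∃ l, 0 < P i l := by
    by_contra! hc
    have h0 := sum_row_of_mem_rowStochastic hP i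
    have h1 : ∑ l, P i l ≤ 0 := Finset.sum_nonpos fun l _ => hc l
    linarith
  obtain ⟨k, hk⟩ := h l j
  refine ⟨k + 1, k.succ_pos, ?_⟩
  rw [pow_succ', mul_apply]
  exact Finset.sum_pos' (fun m _ => mul_nonneg (hP.1 _ _) ((pow_mem hP k).1 _ _))
    ⟨l, mem_univ _, mul_pos hl hk⟩

theorem pow_mulVec_eq_of_mulVec_eq {u : S → ℝ} (hu : P *ᵥ u = u) (k : ℕ) : (P ^ k) *ᵥ u = u := by
  induction k with
  | zero => simp
  | succ k ih => rw [pow_succ, ← mulVec_mulVec, hu, ih]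

/-- Harmonic functions of an irreducible chain are constant. -/
theorem eq_of_mulVec_eq (hP : P ∈ rowStochastic ℝ S) (h : P.IsIrreducible)
    {u : S → ℝ} (hu : P *ᵥ u = u) (i j : S) : u i = u j := by
  have : Nonempty S := ⟨i⟩
  obtain ⟨m, hm⟩ := Finite.exists_max u
  suffices H : ∀ j, u j = u m by rw [H i, H j]
  intro j
  obtain ⟨k, -, hk⟩ := (isIrreducible_iff_exists_pow_pos hP.1).1 h m j
  have hPk := pow_mem hP k
  -- Maximum principle: `u m` is a weighted mean of values not exceeding it, so every state reached
  -- from `m` carries the value `u m`.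
  have h1 : ∑ l, (P ^ k) m l * (u m - u l) = 0 := by
    have h2 : ∑ l, (P ^ k) m l * u l = u m := congrFun (pow_mulVec_eq_of_mulVec_eq hu k) m
    simp only [mul_sub, Finset.sum_sub_distrib, ← Finset.sum_mul, h2,
      sum_row_of_mem_rowStochastic hPk m]
    ring
  have h3 := (Finset.sum_eq_zero_iff_of_nonneg
    (fun l _ => mul_nonneg (hPk.1 m l) (sub_nonneg.2 (hm l)))).1 h1 j (mem_univ j)
  rcases mul_eq_zero.1 h3 with h4 | h4
  · exact absurd h4 hk.ne'
  · linarith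

theorem abs_mulVec_le_of_rowStochastic (hP : P ∈ rowStochastic ℝ S) {u : S → ℝ} {C : ℝ}
    (hC : ∀ i, |u i| ≤ C) (i : S) : |(P *ᵥ u) i| ≤ C := by
  calc |(P *ᵥ u) i| ≤ ∑ j, |P i j * u j| := Finset.abs_sum_le_sum_abs _ _
    _ ≤ ∑ j, P i j * C := by
        refine Finset.sum_le_sum fun j _ => ?_
        rw [abs_mul, abs_of_nonneg (hP.1 i j)]
        exact mul_le_mul_of_nonneg_left (hC j) (hP.1 i j)
    _ = C := by rw [← Finset.sum_mul, sum_row_of_mem_rowStochastic hP, one_mul]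

/-- If `π` is stationary for the irreducible chain `P`, every function with `π`-mean zero is of the
form `u - P u`. -/
theorem exists_sub_mulVec_eq (hP : P ∈ rowStochastic ℝ S) (h : P.IsIrreducible) {π : S → ℝ}
    (hπ : π ∈ stdSimplex ℝ S) (hst : π ᵥ* P = π) {f : S → ℝ} (hf : π ⬝ᵥ f = 0) :
    ∃ u, u - P *ᵥ u = f := by
  -- The kernel of `1 - P` consists of the constants. Adding the `π`-mean makes the map injective,
  -- hence surjective in finite dimension, and changes nothing on functions of mean zero.
  let T : (S → ℝ) →ₗ[ℝ] (S → ℝ) :=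
    { toFun := fun u => u - P *ᵥ u + fun _ => π ⬝ᵥ u
      map_add' := by
        intro u v; ext i; simp [mulVec_add, dotProduct_add]; ring
      map_smul' := by
        intro c u; ext i; simp [mulVec_smul, dotProduct_smul]; ring }
  have hπT : ∀ u, π ⬝ᵥ T u = π ⬝ᵥ u := by
    intro u
    have h1 : π ⬝ᵥ (fun _ : S => π ⬝ᵥ u) = π ⬝ᵥ u := by
      simp only [dotProduct]
      rw [← Finset.sum_mul, hπ.2, one_mul]
    change π ⬝ᵥ (u - P *ᵥ u + fun _ => π ⬝ᵥ u) = _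
    rw [dotProduct_add, dotProduct_sub, dotProduct_mulVec, hst, h1]
    ring
  have hT : ∀ u, π ⬝ᵥ u = 0 → T u = u - P *ᵥ u := by
    intro u hu
    ext i
    change (u - P *ᵥ u) i + π ⬝ᵥ u = _
    rw [hu, add_zero]
  have hinj : Function.Injective T := by
    rw [← LinearMap.ker_eq_bot, LinearMap.ker_eq_bot']
    intro u hu
    have h0 : π ⬝ᵥ u = 0 := by rw [← hπT, hu, dotProduct_zero]
    have h1 : P *ᵥ u = u := by
      rw [hT u h0] at hu
      exact (sub_eq_zero.1 hu).symm
    ext i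
    have h2 : π ⬝ᵥ u = u i := by
      simp only [dotProduct]
      rw [Finset.sum_congr rfl fun j _ => by rw [eq_of_mulVec_eq hP h h1 j i], ← Finset.sum_mul,
        hπ.2, one_mul]
    rw [← h2, h0, Pi.zero_apply]
  obtain ⟨u, hu⟩ := LinearMap.injective_iff_surjective.1 hinj f
  exact ⟨u, by rw [← hT u (by rw [← hπT, hu, hf]), hu]⟩

/-- The mean ergodic theorem for finite irreducible Markov chains. -/
theorem tendsto_average_pow (hP : P ∈ rowStochastic ℝ S) (h : P.IsIrreducible) {π : S → ℝ}
    (hπ : π ∈ stdSimplex ℝ S) (hst : π ᵥ* P = π) (x y : S) :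
    Filter.Tendsto (fun n : ℕ => (n : ℝ)⁻¹ * ∑ k ∈ Finset.range n, (P ^ k) x y) Filter.atTop
      (nhds (π y)) := by
  obtain ⟨u, hu⟩ := exists_sub_mulVec_eq hP h hπ hst
    (f := Pi.single y 1 - fun _ => π y) (by
      rw [dotProduct_sub, dotProduct_single_one]
      simp only [dotProduct]
      rw [← Finset.sum_mul, hπ.2, one_mul, sub_self])
  -- Apply `P ^ k` to the equation for `u`; the right side telescopes over `k`, leaving a bounded
  -- error to be divided by `n`.
  have hk : ∀ k, (P ^ k) x y - π y = ((P ^ k) *ᵥ u) x - ((P ^ (k + 1)) *ᵥ u) x := by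
    intro k
    have h1 := congrFun (congrArg ((P ^ k) *ᵥ ·) hu) x
    simp only [mulVec_sub, mulVec_mulVec, ← pow_succ, mulVec_single_one, Pi.sub_apply] at h1
    have h2 : ((P ^ k) *ᵥ fun _ => π y) x = π y := by
      simp only [mulVec, dotProduct]
      rw [← Finset.sum_mul, sum_row_of_mem_rowStochastic (pow_mem hP k), one_mul]
    rw [h2] at h1
    exact h1.symm
  have hsum : ∀ n : ℕ, ∑ k ∈ Finset.range n, (P ^ k) x y = n * π y + (u x - ((P ^ n) *ᵥ u) x) := by
    intro n
    induction n with
    | zero => simp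
    | succ n ih =>
      rw [Finset.sum_range_succ, ih]
      have := hk n
      push_cast
      linarith
  have : Nonempty S := ⟨x⟩
  obtain ⟨m, hm⟩ := Finite.exists_max fun i => |u i|
  have hb : Filter.Tendsto (fun n : ℕ => (n : ℝ)⁻¹ * (u x - ((P ^ n) *ᵥ u) x)) Filter.atTop
      (nhds 0) := by
    refine squeeze_zero_norm (a := fun n : ℕ => (n : ℝ)⁻¹ * (2 * |u m|)) (fun n => ?_) ?_
    · rw [norm_mul, norm_inv, Real.norm_natCast, Real.norm_eq_abs]
      refine mul_le_mul_of_nonneg_left ?_ (by positivity)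
      have h1 := abs_mulVec_le_of_rowStochastic (pow_mem hP n) hm x
      have h2 := abs_sub (u x) (((P ^ n) *ᵥ u) x)
      have h3 := hm x
      linarith
    · simpa using (tendsto_inv_atTop_nhds_zero_nat (𝕜 := ℝ)).mul_const (2 * |u m|)
  have hlim : Filter.Tendsto (fun n : ℕ => π y + (n : ℝ)⁻¹ * (u x - ((P ^ n) *ᵥ u) x))
      Filter.atTop (nhds (π y)) := by
    simpa using hb.const_add (π y)
  refine hlim.congr' ?_
  filter_upwards [Filter.eventually_gt_atTop 0] with n hn
  rw [hsum, mul_add, inv_mul_cancel_left₀ (by positivity)]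

/-- A stochastic, symmetric matrix all of whose states communicate is ergodic with respect to the
uniform distribution. -/
theorem isErgodicChain_uniformDist [Nonempty S] (hP : P ∈ rowStochastic ℝ S)
    (hsymm : ∀ i j, P i j = P j i) (h : ∀ i j, ∃ k, 0 < (P ^ k) i j) :
    IsErgodicChain P (uniformDist S) := by
  have hirr := isIrreducible_of_rowStochastic hP h
  have hprob : uniformDist S ∈ stdSimplex ℝ S :=
    ⟨fun i => by simp only [uniformDist]; positivity, by simp [uniformDist]⟩
  have hst : uniformDist S ᵥ* P = uniformDist S := by
    ext j
    simp only [vecMul, dotProduct, uniformDist, ← Finset.mul_sum]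
    rw [Finset.sum_congr rfl fun i _ => hsymm i j, sum_row_of_mem_rowStochastic hP, mul_one]
  exact ⟨hP, hprob, hst, hirr, tendsto_average_pow hP hirr hprob hst⟩

end Markov

namespace UGS

open EditableGraph

section

variable {V X : Type*} [EditableGraph X V]

/-! ### Edge swaps -/

open Classical in
/-- What the sampler needs to know about a class `𝒢` of graphs. Here `P w₀ G w` says that `G` can
occur as the current graph while the iteration started at `w₀` is at `w`: its edges at `w` exceed
those of the graphs in `𝒢` by one, unless `w = w₀`. -/
structure IsSwapSystem (𝒢 : Set X) (P : V → X → V → Prop) : Prop where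
  ext : ∀ {G H : X}, (∀ u v, HasEdge G u v ↔ HasEdge H u v) → G = H
  mem_iff : ∀ {w₀ G}, P w₀ G w₀ ↔ G ∈ 𝒢
  hasEdge_iff : ∀ {w₀ G w H u v}, P w₀ G w → H ∈ 𝒢 → Known 𝒢 u v →
    (HasEdge G u v ↔ HasEdge H u v)
  ncard_in : ∀ {w₀ G w H}, P w₀ G w → H ∈ 𝒢 →
    {v | HasEdge G v w}.ncard = {v | HasEdge H v w}.ncard + if w = w₀ then 0 else 1
  ncard_out : ∀ {w₀ G w H a}, P w₀ G w → H ∈ 𝒢 → HasEdge G a w →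
    {b | HasEdge G a b}.ncard ≤ {b | HasEdge H a b}.ncard
  swap : ∀ {w₀ G w a b}, P w₀ G w → HasEdge G a w → ¬ Known 𝒢 a w → ¬ HasEdge G a b →
    ¬ Known 𝒢 a b → P w₀ (swapEdge G a w b) b
  hasEdge_swap : ∀ {G : X} {w a b y}, HasEdge G a w → ¬ HasEdge G a b → ¬ Known 𝒢 a b →
    (HasEdge (swapEdge G a w b) a y ↔ (HasEdge G a y ∧ y ≠ w) ∨ y = b)
  swap_swap : ∀ {G : X} {w a b}, HasEdge G a w → ¬ HasEdge G a b → ¬ Known 𝒢 a b →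
    swapEdge (swapEdge G a w b) a b w = G
  of_hasEdge_swap : ∀ {G H : X} {w a b x y}, HasEdge H a b → HasEdge (swapEdge G a w b) x y →
    ¬ HasEdge H x y → HasEdge G x y

variable {𝒢 : Set X} {P : V → X → V → Prop}

theorem Known.hasEdge_iff {u v : V}
    (h : Known 𝒢 u v) {G H : X} (hG : G ∈ 𝒢) (hH : H ∈ 𝒢) : HasEdge G u v ↔ HasEdge H u v := by
  rcases h with h | h
  · exact iff_of_true (h G hG) (h H hH)
  · exact iff_of_false (h G hG) (h H hH)

theorem IsSwapSystem.not_known (hS : IsSwapSystem 𝒢 P) {w₀ w : V} {G H : X} {u v : V}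
    (hG : P w₀ G w) (hH : H ∈ 𝒢) (h : ¬ (HasEdge G u v ↔ HasEdge H u v)) : ¬ Known 𝒢 u v :=
  fun hk => h (hS.hasEdge_iff hG hH hk)

/-! ### Candidate sets, their sizes, and reversal of a swap -/

variable [Fintype V]

@[simp] theorem mem_inNbrs {G : X} {u v : V} :
    v ∈ inNbrs 𝒢 G u ↔ HasEdge G v u ∧ ¬ Known 𝒢 v u := by simp [inNbrs]

@[simp] theorem mem_nonOutNbrs {G : X} {u v : V} :
    v ∈ nonOutNbrs 𝒢 G u ↔ ¬ HasEdge G u v ∧ ¬ Known 𝒢 u v := by simp [nonOutNbrs]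

@[simp] theorem mem_inNbrsAvoid {G : X} {p : Option V} {u v : V} :
    v ∈ inNbrsAvoid 𝒢 G p u ↔ (HasEdge G v u ∧ ¬ Known 𝒢 v u) ∧ some v ≠ p := by
  simp [inNbrsAvoid]

@[simp] theorem mem_startSet {G : X} {v : V} :
    v ∈ startSet 𝒢 G ↔ (inNbrs 𝒢 G v).Nonempty := by simp [startSet]

/-- The loop can be entered with current graph `G`, `W_{n-1} = p` and `W_n = w`. -/
def IsState (𝒢 : Set X) (P : V → X → V → Prop) (w₀ : V) (G : X) (p : Option V) (w : V) : Prop :=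
  P w₀ G w ∧ (p = none ∧ w = w₀ ∨ ∃ a ∈ inNbrs 𝒢 G w, p = some a ∧ w ≠ w₀)

namespace IsSwapSystem

/-- Otherwise the heads at `a` in `H` would be among those in `G`, which are no more numerous, so
the two sets would coincide. -/
theorem exists_out (hS : IsSwapSystem 𝒢 P) {w₀ w a : V} {G H : X} (hG : P w₀ G w) (hH : H ∈ 𝒢)
    (h : HasEdge G a w) (h' : ¬ HasEdge H a w) : ∃ b, HasEdge H a b ∧ ¬ HasEdge G a b := by
  by_contra! hc
  have := Set.eq_of_subset_of_ncard_le (s := {b | HasEdge H a b}) (t := {b | HasEdge G a b})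
    (fun b hb => hc b hb) (hS.ncard_out hG hH h)
  exact h' (this.ge h)

theorem exists_in (hS : IsSwapSystem 𝒢 P) {w₀ w : V} {G H : X} (hG : P w₀ G w) (hH : H ∈ 𝒢)
    (hw : w ≠ w₀) : ∃ c, HasEdge G c w ∧ ¬ HasEdge H c w := by
  by_contra! hc
  have h1 := Set.ncard_le_ncard (s := {v | HasEdge G v w}) (t := {v | HasEdge H v w})
    (fun b hb => hc b hb)
  have h2 := hS.ncard_in hG hH
  rw [if_neg hw] at h2
  omega

/-- The loop never gets stuck: `aw` is unknown, so some graph of the class lacks it and has another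
edge at `a` in its place. -/
theorem nonOutNbrs_nonempty (hS : IsSwapSystem 𝒢 P) {w₀ w a : V} {G : X} (hG : P w₀ G w)
    (ha : a ∈ inNbrs 𝒢 G w) : (nonOutNbrs 𝒢 G a).Nonempty := by
  rw [mem_inNbrs] at ha
  have hk := ha.2
  simp only [Known, not_or, not_forall] at hk
  obtain ⟨⟨H, hH, h⟩, -⟩ := hk
  obtain ⟨b, hb, hb'⟩ := hS.exists_out hG hH ha.1 h
  exact ⟨b, mem_nonOutNbrs.2 ⟨hb', hS.not_known hG hH fun h => hb' (h.2 hb)⟩⟩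

open Classical in
theorem ncard_in_eq (𝒢 : Set X) (G : X) (w : V) :
    {v | HasEdge G v w}.ncard =
      (inNbrs 𝒢 G w).card + (Finset.univ.filter fun v => HasEdge G v w ∧ Known 𝒢 v w).card := by
  rw [inNbrs, Set.ncard_eq_toFinset_card', Set.toFinset_ofPred, add_comm,
    ← Finset.card_filter_add_card_filter_not (p := fun v => Known 𝒢 v w), Finset.filter_filter,
    Finset.filter_filter]

open Classical in
theorem card_inNbrs (hS : IsSwapSystem 𝒢 P) {w₀ w : V} {G H : X} (hG : P w₀ G w) (hH : H ∈ 𝒢) :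
    (inNbrs 𝒢 G w).card = (inNbrs 𝒢 H w).card + if w = w₀ then 0 else 1 := by
  classical
  have h := hS.ncard_in hG hH
  rw [ncard_in_eq 𝒢, ncard_in_eq 𝒢, Finset.filter_congr (p := fun v => HasEdge G v w ∧ Known 𝒢 v w)
    (q := fun v => HasEdge H v w ∧ Known 𝒢 v w)
    fun v _ => and_congr_left fun hk => hS.hasEdge_iff hG hH hk] at h
  omega

theorem card_inNbrs_of_mem (hS : IsSwapSystem 𝒢 P) {w : V} {G H : X} (hG : G ∈ 𝒢) (hH : H ∈ 𝒢) :
    (inNbrs 𝒢 G w).card = (inNbrs 𝒢 H w).card := by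
  simpa using hS.card_inNbrs (hS.mem_iff (w₀ := w).2 hG) hH

theorem startSet_eq (hS : IsSwapSystem 𝒢 P) {G H : X} (hG : G ∈ 𝒢) (hH : H ∈ 𝒢) :
    startSet 𝒢 G = startSet 𝒢 H := by
  ext v
  rw [mem_startSet, mem_startSet, ← Finset.card_pos, ← Finset.card_pos, hS.card_inNbrs_of_mem hG hH]

/-- At the start there is neither a surplus edge nor an excluded tail; at `w ≠ w₀` the two cancel.
The tail is thus drawn with a weight depending only on `w`. -/
theorem card_inNbrsAvoid (hS : IsSwapSystem 𝒢 P) {w₀ w : V} {p : Option V} {G H : X}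
    (h : IsState 𝒢 P w₀ G p w) (hH : H ∈ 𝒢) :
    (inNbrsAvoid 𝒢 G p w).card = (inNbrs 𝒢 H w).card := by
  classical
  obtain ⟨hG, ⟨rfl, rfl⟩ | ⟨a, ha, rfl, hw⟩⟩ := h
  · have : inNbrsAvoid 𝒢 G none w = inNbrs 𝒢 G w := by ext; simp
    simpa [this] using hS.card_inNbrs hG hH
  · have : inNbrsAvoid 𝒢 G (some a) w = (inNbrs 𝒢 G w).erase a := by ext; simp; tauto
    rw [this, Finset.card_erase_of_mem ha, hS.card_inNbrs hG hH, if_neg hw]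
    rfl

theorem mem_inNbrs_swap (hS : IsSwapSystem 𝒢 P) {w a b : V} {G : X} (ha : a ∈ inNbrs 𝒢 G w)
    (hb : b ∈ nonOutNbrs 𝒢 G a) : a ∈ inNbrs 𝒢 (swapEdge G a w b) b := by
  rw [mem_inNbrs] at *
  rw [mem_nonOutNbrs] at hb
  exact ⟨(hS.hasEdge_swap ha.1 hb.1 hb.2).2 (Or.inr rfl), hb.2⟩

theorem isState_swap (hS : IsSwapSystem 𝒢 P) {w₀ w a b : V} {G : X} (hG : P w₀ G w)
    (ha : a ∈ inNbrs 𝒢 G w) (hb : b ∈ nonOutNbrs 𝒢 G a) (hbw : b ≠ w₀) :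
    IsState 𝒢 P w₀ (swapEdge G a w b) (some a) b := by
  refine ⟨?_, Or.inr ⟨a, hS.mem_inNbrs_swap ha hb, rfl, hbw⟩⟩
  rw [mem_inNbrs] at ha
  rw [mem_nonOutNbrs] at hb
  exact hS.swap hG ha.1 ha.2 hb.1 hb.2

theorem swap_mem (hS : IsSwapSystem 𝒢 P) {w₀ w a b : V} {G : X} (hG : P w₀ G w)
    (ha : a ∈ inNbrs 𝒢 G w) (hb : b ∈ nonOutNbrs 𝒢 G a) (hbw : b = w₀) :
    swapEdge G a w b ∈ 𝒢 := by
  rw [mem_inNbrs] at ha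
  rw [mem_nonOutNbrs] at hb
  subst hbw
  exact hS.mem_iff.1 (hS.swap hG ha.1 ha.2 hb.1 hb.2)

theorem mem_nonOutNbrs_swap (hS : IsSwapSystem 𝒢 P) {w a b : V} {G : X} (ha : a ∈ inNbrs 𝒢 G w)
    (hb : b ∈ nonOutNbrs 𝒢 G a) : w ∈ nonOutNbrs 𝒢 (swapEdge G a w b) a := by
  rw [mem_inNbrs] at ha
  rw [mem_nonOutNbrs] at *
  refine ⟨fun h => ?_, ha.2⟩
  rcases (hS.hasEdge_swap ha.1 hb.1 hb.2).1 h with h | rfl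
  · exact h.2 rfl
  · exact hb.1 ha.1

/-- The swap exchanges `b` for `w` in the set of admissible heads, so a swap and its reverse have
equal weights. -/
theorem card_nonOutNbrs_swap (hS : IsSwapSystem 𝒢 P) {w a b : V} {G : X} (ha : a ∈ inNbrs 𝒢 G w)
    (hb : b ∈ nonOutNbrs 𝒢 G a) :
    (nonOutNbrs 𝒢 (swapEdge G a w b) a).card = (nonOutNbrs 𝒢 G a).card := by
  classical
  have hwb : w ∉ nonOutNbrs 𝒢 G a := fun h => (mem_nonOutNbrs.1 h).1 (mem_inNbrs.1 ha).1
  have : nonOutNbrs 𝒢 (swapEdge G a w b) a = insert w ((nonOutNbrs 𝒢 G a).erase b) := by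
    ext y
    rw [mem_inNbrs] at ha
    rw [mem_nonOutNbrs] at hb
    rw [mem_nonOutNbrs, hS.hasEdge_swap ha.1 hb.1 hb.2, Finset.mem_insert, Finset.mem_erase,
      mem_nonOutNbrs]
    by_cases hy : y = w
    · subst hy
      have : y ≠ b := fun h => hb.1 (h ▸ ha.1)
      tauto
    · tauto
  rw [this, Finset.card_insert_of_notMem (fun h => hwb (Finset.mem_of_mem_erase h)),
    Finset.card_erase_add_one hb]

theorem swapEdge_swapEdge (hS : IsSwapSystem 𝒢 P) {w a b : V} {G : X} (ha : a ∈ inNbrs 𝒢 G w)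
    (hb : b ∈ nonOutNbrs 𝒢 G a) : swapEdge (swapEdge G a w b) a b w = G := by
  rw [mem_inNbrs] at ha
  rw [mem_nonOutNbrs] at hb
  exact hS.swap_swap ha.1 hb.1 hb.2

end IsSwapSystem

/-! ### Paths towards a target graph -/

/-- The loop, entered with current graph `G`, `W_{n-1} = p` and `W_n = w`, may return `H`. -/
inductive Exits (𝒢 : Set X) (w₀ : V) : X → Option V → V → X → Prop
  | last {G p w a b} (ha : a ∈ inNbrsAvoid 𝒢 G p w) (hb : b ∈ nonOutNbrs 𝒢 G a) (h : b = w₀) :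
      Exits 𝒢 w₀ G p w (swapEdge G a w b)
  | step {G p w a b H} (ha : a ∈ inNbrsAvoid 𝒢 G p w) (hb : b ∈ nonOutNbrs 𝒢 G a) (h : b ≠ w₀)
      (hH : Exits 𝒢 w₀ (swapEdge G a w b) (some a) b H) : Exits 𝒢 w₀ G p w H

/-- The number of edges of `G` that are not edges of `H`. -/
noncomputable def excess (G H : X) : ℕ :=
  {e : V × V | HasEdge G e.1 e.2 ∧ ¬ HasEdge H e.1 e.2}.ncard

/-- The inserted edge lies in `H` and creates no excess, while the removed one was excess. -/
theorem IsSwapSystem.excess_swap_lt (hS : IsSwapSystem 𝒢 P) {G H : X} {w a b : V}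
    (ha : a ∈ inNbrs 𝒢 G w) (hb : b ∈ nonOutNbrs 𝒢 G a) (haH : ¬ HasEdge H a w)
    (hbH : HasEdge H a b) : excess (swapEdge G a w b) H < excess G H := by
  refine Set.ncard_lt_ncard ⟨fun e he => ⟨hS.of_hasEdge_swap hbH he.1 he.2, he.2⟩, fun hc => ?_⟩
  have h1 : (a, w) ∈ {e : V × V | HasEdge G e.1 e.2 ∧ ¬ HasEdge H e.1 e.2} :=
    ⟨(mem_inNbrs.1 ha).1, haH⟩
  exact (mem_nonOutNbrs.1 (hS.mem_nonOutNbrs_swap ha hb)).1 (hc h1).1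

/-- Greedy steering towards `H`: remove an edge outside `H`, insert one of `H` with the same tail.
If this does not close the loop, the surplus at the new vertex gives another edge outside `H`. The
excess drops each time, so the loop must close. -/
theorem IsSwapSystem.exists_exits (hS : IsSwapSystem 𝒢 P) {w₀ : V} {H : X} (hH : H ∈ 𝒢) (n : ℕ) :
    ∀ {G : X} {p : Option V} {w c : V}, excess G H = n → P w₀ G w → HasEdge G c w →
      ¬ HasEdge H c w → some c ≠ p →
      ∃ G' ∈ 𝒢, Exits 𝒢 w₀ G p w G' ∧ excess G' H < excess G H := by
  induction n using Nat.strong_induction_on with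
  | _ n ih =>
    intro G p w c hn hG hc hc' hp
    have hck : ¬ Known 𝒢 c w := hS.not_known hG hH fun h => hc' (h.1 hc)
    obtain ⟨b, hb, hb'⟩ := hS.exists_out hG hH hc hc'
    have hcm : c ∈ inNbrs 𝒢 G w := mem_inNbrs.2 ⟨hc, hck⟩
    have hca : c ∈ inNbrsAvoid 𝒢 G p w := mem_inNbrsAvoid.2 ⟨⟨hc, hck⟩, hp⟩
    have hbm : b ∈ nonOutNbrs 𝒢 G c :=
      mem_nonOutNbrs.2 ⟨hb', hS.not_known hG hH fun h => hb' (h.2 hb)⟩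
    have hlt := hS.excess_swap_lt hcm hbm hc' hb
    by_cases hbw : b = w₀
    · exact ⟨_, hS.swap_mem hG hcm hbm hbw, Exits.last hca hbm hbw, hlt⟩
    · have hst := (hS.isState_swap hG hcm hbm hbw).1
      obtain ⟨d, hd, hd'⟩ := hS.exists_in hst hH hbw
      obtain ⟨G', hG', he, hl⟩ := ih _ (hn ▸ hlt) (p := some c) rfl hst hd hd'
        -- The next tail `d` differs from the excluded `c`, since `cb` was chosen in `H` and `db` is
        -- not in `H`.
        (fun h => hd' (Option.some.inj h ▸ hb))
      exact ⟨G', hG', Exits.step hca hbm hbw he, hl.trans hlt⟩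

/-- The target is chosen to contain the unknown edge `aw`; the surplus edge at `w` lying outside it
then has a tail other than the excluded `a`. -/
theorem IsSwapSystem.exists_exits_of_isState (hS : IsSwapSystem 𝒢 P) {w₀ a w : V} {G : X}
    (h : IsState 𝒢 P w₀ G (some a) w) : ∃ G', Exits 𝒢 w₀ G (some a) w G' := by
  obtain ⟨hG, ⟨h', -⟩ | ⟨a', ha, h', hw⟩⟩ := h
  · cases h'
  · cases h'
    have hk := (mem_inNbrs.1 ha).2
    simp only [Known, not_or, not_forall, not_not] at hk
    obtain ⟨-, ⟨H, hH, hHa⟩⟩ := hk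
    obtain ⟨d, hd, hd'⟩ := hS.exists_in hG hH hw
    obtain ⟨G', -, he, -⟩ := hS.exists_exits hH _ rfl hG hd hd' (p := some a)
      (fun h => hd' (Option.some.inj h ▸ hHa))
    exact ⟨G', he⟩

/-- Distinct graphs of the class: some vertex has an edge of the first that is not in the second. -/
theorem IsSwapSystem.exists_hasEdge_of_ne (hS : IsSwapSystem 𝒢 P) {G H : X} (hG : G ∈ 𝒢)
    (hH : H ∈ 𝒢) (hne : G ≠ H) : ∃ c w, HasEdge G c w ∧ ¬ HasEdge H c w := by
  by_contra! hc
  refine hne (hS.ext fun u v => ?_)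
  have h := Set.eq_of_subset_of_ncard_le (s := {u | HasEdge G u v}) (t := {u | HasEdge H u v})
    (fun u hu => hc u v hu) (by simpa using (hS.ncard_in (hS.mem_iff (w₀ := v).2 hH) hG).le)
  exact Set.ext_iff.1 h u

end

/-! ### Reversibility

The loop alternates between two symmetric matrices indexed by `V × X × V`: the entries of the first
describe the replacement of an edge with given tail, those of the second the choice of a new
tail. -/

section

variable {V X : Type*}

open Classical in
/-- The weight of choosing a new tail at a vertex `w ≠ w₀`, which is to be one of `d w` others. -/
noncomputable def turnMatrix (X : Type*) (d : V → ℕ) (w₀ : V) :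
    Matrix (V × X × V) (V × X × V) ℝ≥0∞ :=
  Matrix.of fun x y => if x.1 ≠ y.1 ∧ x.2 = y.2 ∧ x.2.2 ≠ w₀ then (d x.2.2 : ℝ≥0∞)⁻¹ else 0

open Classical in
/-- The indicator function of the event that the graph is `H` and the position is `w₀`. -/
noncomputable def endVec (H : X) (w₀ : V) : V × X × V → ℝ≥0∞ :=
  fun x => if x.2.1 = H ∧ x.2.2 = w₀ then 1 else 0

theorem turnMatrix_transpose (d : V → ℕ) (w₀ : V) :
    (turnMatrix X d w₀).transpose = turnMatrix X d w₀ := by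
  ext x y
  simp only [turnMatrix, Matrix.transpose_apply, Matrix.of_apply]
  by_cases h : x.2 = y.2
  · classical exact if_congr (by rw [h, ne_comm]) (by rw [h]) rfl
  · simp [h, Ne.symm h]

open Classical in
theorem turnMatrix_mulVec [Fintype V] [Fintype X] (d : V → ℕ) (w₀ p : V) (G : X) (w : V)
    (f : V × X × V → ℝ≥0∞) :
    Matrix.mulVec (turnMatrix X d w₀) f (p, G, w) =
      if w ≠ w₀ then ∑ a, (if a ≠ p then (d w : ℝ≥0∞)⁻¹ else 0) * f (a, G, w) else 0 := by
  simp only [Matrix.mulVec, dotProduct, turnMatrix, Matrix.of_apply, Fintype.sum_prod_type]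
  split_ifs with hw
  · refine Finset.sum_congr rfl fun a _ => ?_
    rw [Finset.sum_eq_single G, Finset.sum_eq_single w]
    · simp [hw, ne_comm]
    · intro b _ hb
      simp [Ne.symm hb]
    · simp
    · intro G' _ hG'
      simp [Ne.symm hG']
    · simp
  · simp [hw]

end

section

variable {V X : Type*} [Fintype V] [EditableGraph X V] {𝒢 : Set X} {P : V → X → V → Prop}

open Classical in
/-- The weight of replacing the edge `aw` of `G` by `ab`. -/
noncomputable def swapMatrix (𝒢 : Set X) (P : V → X → V → Prop) (w₀ : V) :
    Matrix (V × X × V) (V × X × V) ℝ≥0∞ :=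
  Matrix.of fun x y =>
    if x.1 = y.1 ∧ P w₀ x.2.1 x.2.2 ∧ x.1 ∈ inNbrs 𝒢 x.2.1 x.2.2 ∧
      y.2.2 ∈ nonOutNbrs 𝒢 x.2.1 x.1 ∧ y.2.1 = swapEdge x.2.1 x.1 x.2.2 y.2.2
    then ((nonOutNbrs 𝒢 x.2.1 x.1).card : ℝ≥0∞)⁻¹ else 0

/-- Every admissible swap has an admissible reverse, with the same number of heads to choose from.
-/
theorem IsSwapSystem.swapMatrix_transpose (hS : IsSwapSystem 𝒢 P) (w₀ : V) :
    (swapMatrix 𝒢 P w₀).transpose = swapMatrix 𝒢 P w₀ := by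
  have key : ∀ {a w b : V} {G : X}, P w₀ G w → a ∈ inNbrs 𝒢 G w → b ∈ nonOutNbrs 𝒢 G a →
      swapMatrix 𝒢 P w₀ (a, swapEdge G a w b, b) (a, G, w) =
        swapMatrix 𝒢 P w₀ (a, G, w) (a, swapEdge G a w b, b) := by
    intro a w b G hG ha hb
    have hG' : P w₀ (swapEdge G a w b) b := by
      rw [mem_inNbrs] at ha
      rw [mem_nonOutNbrs] at hb
      exact hS.swap hG ha.1 ha.2 hb.1 hb.2
    simp only [swapMatrix, Matrix.of_apply]
    rw [if_pos ⟨rfl, hG', hS.mem_inNbrs_swap ha hb, hS.mem_nonOutNbrs_swap ha hb,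
      (hS.swapEdge_swapEdge ha hb).symm⟩, if_pos ⟨rfl, hG, ha, hb, rfl⟩,
      hS.card_nonOutNbrs_swap ha hb]
  have hne : ∀ {x y : V × X × V}, swapMatrix 𝒢 P w₀ x y ≠ 0 →
      swapMatrix 𝒢 P w₀ y x = swapMatrix 𝒢 P w₀ x y := by
    rintro ⟨a, G, w⟩ ⟨a', G', b⟩ h
    simp only [swapMatrix, Matrix.of_apply, ne_eq, ite_eq_right_iff, not_forall] at h
    obtain ⟨⟨rfl, hG, ha, hb, rfl⟩, -⟩ := h
    exact key hG ha hb
  ext x y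
  rw [Matrix.transpose_apply]
  by_cases h : swapMatrix 𝒢 P w₀ x y = 0
  · by_cases h' : swapMatrix 𝒢 P w₀ y x = 0
    · rw [h, h']
    · exact (hne h').symm
  · exact hne h

variable [Fintype X]

open Classical in
theorem swapMatrix_mulVec (𝒢 : Set X) (P : V → X → V → Prop) (w₀ a : V) (G : X) (w : V)
    (f : V × X × V → ℝ≥0∞) :
    Matrix.mulVec (swapMatrix 𝒢 P w₀) f (a, G, w) =
      if P w₀ G w ∧ a ∈ inNbrs 𝒢 G w then
        ∑ b, unif (nonOutNbrs 𝒢 G a) b * f (a, swapEdge G a w b, b) else 0 := by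
  simp only [Matrix.mulVec, dotProduct, swapMatrix, Matrix.of_apply, Fintype.sum_prod_type]
  split_ifs with hw
  · rw [Finset.sum_eq_single a, Finset.sum_comm]
    · refine Finset.sum_congr rfl fun b _ => ?_
      rw [Finset.sum_eq_single (swapEdge G a w b)]
      · simp [hw, unif]
      · intro G' _ hG'
        simp [hG']
      · simp
    · intro b _ hb
      simp [Ne.symm hb]
    · simp
  · refine Finset.sum_eq_zero fun a' _ => Finset.sum_eq_zero fun G' _ =>
      Finset.sum_eq_zero fun b _ => ?_
    rw [if_neg (fun h => hw ⟨h.2.1, h.2.2.1⟩), zero_mul]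

/-- One pass of the loop in terms of the two matrices, for an arbitrary continuation `f`. -/
theorem sum_pass_eq {w₀ w : V} {p : Option V} {G : X} {m : ℕ} (hG : P w₀ G w)
    (hm : (inNbrsAvoid 𝒢 G p w).card = m) (f : V × X × V → ℝ≥0∞) :
    open Classical in
    ∑ a, ∑ b, unif (inNbrsAvoid 𝒢 G p w) a * unif (nonOutNbrs 𝒢 G a) b *
      f (a, swapEdge G a w b, b) =
    ∑ a, (if some a ≠ p then (m : ℝ≥0∞)⁻¹ else 0) *
      Matrix.mulVec (swapMatrix 𝒢 P w₀) f (a, G, w) := by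
  classical
  refine Finset.sum_congr rfl fun a _ => ?_
  simp only [mul_assoc, ← Finset.mul_sum]
  rw [swapMatrix_mulVec, unif, hm]
  simp only [mem_inNbrsAvoid, mem_inNbrs]
  split_ifs <;> simp_all

/-- The exit probabilities through powers of the matrices. -/
noncomputable def exitVec (𝒢 : Set X) (P : V → X → V → Prop) (d : V → ℕ) (w₀ : V) (H : X)
    (k : ℕ) : V × X × V → ℝ≥0∞ := by
  classical exact
    Matrix.mulVec ((turnMatrix X d w₀ * swapMatrix 𝒢 P w₀) ^ k) (endVec H w₀)

theorem exitVec_zero (d : V → ℕ) (w₀ : V) (H : X) :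
    exitVec 𝒢 P d w₀ H 0 = endVec H w₀ := by simp [exitVec]

theorem exitVec_succ (d : V → ℕ) (w₀ : V) (H : X) (k : ℕ) :
    exitVec 𝒢 P d w₀ H (k + 1) = Matrix.mulVec (turnMatrix X d w₀)
      (Matrix.mulVec (swapMatrix 𝒢 P w₀) (exitVec 𝒢 P d w₀ H k)) := by
  simp only [exitVec, pow_succ', Matrix.mulVec_mulVec, Matrix.mul_assoc]

open Classical in
-- The rows of `turnMatrix` at `w₀` vanish, which stops the walk at its first return; this matches
-- the stopping rule of `exitProb`.
theorem exitVec_apply_start (d : V → ℕ) (w₀ a : V) (G H : X) (k : ℕ) :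
    exitVec 𝒢 P d w₀ H k (a, G, w₀) = if k = 0 ∧ G = H then 1 else 0 := by
  cases k with
  | zero => simp [exitVec_zero, endVec]
  | succ k => simp [exitVec_succ, turnMatrix_mulVec]

theorem IsSwapSystem.exitProb_succ_eq (hS : IsSwapSystem 𝒢 P) {d : V → ℕ} {w₀ : V} {H : X}
    {k m : ℕ} {p : Option V} {G : X} {w : V} (hG : P w₀ G w)
    (hm : (inNbrsAvoid 𝒢 G p w).card = m)
    (ih : ∀ {G : X} {a w : V}, IsState 𝒢 P w₀ G (some a) w →
      exitProb 𝒢 w₀ k G (some a) w H = exitVec 𝒢 P d w₀ H k (a, G, w)) :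
    open Classical in
    exitProb 𝒢 w₀ (k + 1) G p w H = ∑ a, (if some a ≠ p then (m : ℝ≥0∞)⁻¹ else 0) *
      Matrix.mulVec (swapMatrix 𝒢 P w₀) (exitVec 𝒢 P d w₀ H k) (a, G, w) := by
  classical
  rw [← sum_pass_eq hG hm, exitProb]
  refine Finset.sum_congr rfl fun a _ => Finset.sum_congr rfl fun b _ => ?_
  by_cases ha : a ∈ inNbrsAvoid 𝒢 G p w
  · by_cases hb : b ∈ nonOutNbrs 𝒢 G a
    · congr 1
      split_ifs with h1 h2
      · rw [h1, exitVec_apply_start, if_pos (h1 ▸ h2)]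
      · rw [h1, exitVec_apply_start, if_neg (h1 ▸ h2)]
      · exact ih (hS.isState_swap hG (mem_inNbrs.2 (mem_inNbrsAvoid.1 ha).1) hb h1)
    · simp [unif, hb]
  · simp only [unif, if_neg ha, zero_mul]

theorem IsSwapSystem.exitProb_eq (hS : IsSwapSystem 𝒢 P) {G₀ : X} (hG₀ : G₀ ∈ 𝒢) {w₀ : V} {H : X}
    (k : ℕ) : ∀ {G : X} {a w : V}, IsState 𝒢 P w₀ G (some a) w →
      exitProb 𝒢 w₀ k G (some a) w H =
        exitVec 𝒢 P (fun v => (inNbrs 𝒢 G₀ v).card) w₀ H k (a, G, w) := by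
  classical
  induction k with
  | zero =>
    rintro G a w ⟨-, ⟨h, -⟩ | ⟨-, -, -, hw⟩⟩
    · cases h
    · simp [exitProb, exitVec_zero, endVec, hw]
  | succ k ih =>
    intro G a w h
    have hw : w ≠ w₀ := by
      obtain ⟨-, ⟨h, -⟩ | ⟨-, -, -, hw⟩⟩ := h
      · cases h
      · exact hw
    rw [hS.exitProb_succ_eq h.1 (hS.card_inNbrsAvoid h hG₀) ih, exitVec_succ, turnMatrix_mulVec,
      if_pos hw]
    simp

/-- The bilinear form that gives the exit probabilities of the loop from its start. -/
theorem IsSwapSystem.exitProb_start_eq (hS : IsSwapSystem 𝒢 P) {G₀ : X} (hG₀ : G₀ ∈ 𝒢) {w₀ : V}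
    {G H : X} (hG : G ∈ 𝒢) (k : ℕ) :
    exitProb 𝒢 w₀ (k + 1) G none w₀ H = ((inNbrs 𝒢 G₀ w₀).card : ℝ≥0∞)⁻¹ *
      (endVec G w₀ ⬝ᵥ Matrix.mulVec (swapMatrix 𝒢 P w₀)
        (exitVec 𝒢 P (fun v => (inNbrs 𝒢 G₀ v).card) w₀ H k)) := by
  classical
  have hP : P w₀ G w₀ := hS.mem_iff.2 hG
  rw [hS.exitProb_succ_eq hP (hS.card_inNbrsAvoid ⟨hP, Or.inl ⟨rfl, rfl⟩⟩ hG₀)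
    (hS.exitProb_eq hG₀ k)]
  -- No tail is excluded at the start, so the weight is the same for all `a` and factors out. What
  -- remains is a pairing with `endVec`, which ignores the tail coordinate.
  simp only [ne_eq, reduceCtorEq, not_false_eq_true, if_true, ← Finset.mul_sum]
  congr 1
  simp only [dotProduct, Fintype.sum_prod_type]
  refine Finset.sum_congr rfl fun a _ => ?_
  rw [Finset.sum_eq_single G, Finset.sum_eq_single w₀]
  · simp [endVec]
  · intro b _ hb
    simp [endVec, hb]
  · simp
  · intro G' _ hG'
    simp [endVec, hG']
  · simp

theorem IsSwapSystem.dotProduct_exitVec_comm (hS : IsSwapSystem 𝒢 P) (d : V → ℕ) (w₀ : V)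
    (G H : X) (k : ℕ) :
    endVec G w₀ ⬝ᵥ Matrix.mulVec (swapMatrix 𝒢 P w₀) (exitVec 𝒢 P d w₀ H k) =
      endVec H w₀ ⬝ᵥ Matrix.mulVec (swapMatrix 𝒢 P w₀) (exitVec 𝒢 P d w₀ G k) := by
  classical
  set A := swapMatrix 𝒢 P w₀
  set J := turnMatrix X d w₀
  have hA : A.transpose = A := hS.swapMatrix_transpose w₀
  have hJ : J.transpose = J := turnMatrix_transpose d w₀
  -- `A J A ⋯ J A` is a palindrome in symmetric matrices.
  have hsymm : (A * (J * A) ^ k).transpose = A * (J * A) ^ k := by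
    rw [Matrix.transpose_mul, Matrix.transpose_pow, Matrix.transpose_mul, hA, hJ]
    induction k with
    | zero => simp
    | succ k ih =>
      rw [pow_succ, mul_assoc, mul_assoc A J A, ← mul_assoc _ A, ih, mul_assoc, ← pow_succ]
  simp only [exitVec, Matrix.mulVec_mulVec]
  rw [Matrix.dotProduct_mulVec, ← Matrix.mulVec_transpose, hsymm, dotProduct_comm]

theorem IsSwapSystem.exitProb_comm (hS : IsSwapSystem 𝒢 P) {G H : X} (hG : G ∈ 𝒢) (hH : H ∈ 𝒢)
    (w₀ : V) (k : ℕ) : exitProb 𝒢 w₀ k G none w₀ H = exitProb 𝒢 w₀ k H none w₀ G := by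
  cases k with
  | zero => simp [exitProb]
  | succ k =>
    rw [hS.exitProb_start_eq hG hG, hS.exitProb_start_eq hG hH, hS.dotProduct_exitVec_comm]

theorem IsSwapSystem.iterProb_comm (hS : IsSwapSystem 𝒢 P) {G H : X} (hG : G ∈ 𝒢) (hH : H ∈ 𝒢) :
    iterProb 𝒢 G H = iterProb 𝒢 H G := by
  classical
  simp only [iterProb, hS.startSet_eq hG hH, hS.exitProb_comm hG hH, eq_comm]

end

/-! ### Uniform sampling and weighted means -/

theorem sum_unif_le_one {β : Type*} [Fintype β] [DecidableEq β] (s : Finset β) :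
    ∑ b, unif s b ≤ 1 := by
  simp only [unif, Finset.sum_ite_mem, Finset.univ_inter, Finset.sum_const, nsmul_eq_mul]
  exact ENNReal.mul_inv_le_one _

theorem sum_unif {β : Type*} [Fintype β] [DecidableEq β] {s : Finset β} (hs : s.Nonempty) :
    ∑ b, unif s b = 1 := by
  simp only [unif, Finset.sum_ite_mem, Finset.univ_inter, Finset.sum_const, nsmul_eq_mul]
  exact ENNReal.mul_inv_cancel (by simpa using hs.ne_empty) (by simp)

theorem unif_ne_zero {β : Type*} [DecidableEq β] {s : Finset β} {b : β} :
    unif s b ≠ 0 ↔ b ∈ s := by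
  simp [unif]

/-- If a weighted mean does not exceed a lower bound of the values, then all the values that carry
weight are equal to that bound. -/
theorem eq_of_sum_mul_le {ι : Type*} [Fintype ι] {K c : ι → ℝ≥0∞} {m : ℝ≥0∞} (hm : m ≠ ∞)
    (hK : ∑ i, K i = 1) (hc : ∀ i, K i ≠ 0 → m ≤ c i) (h : ∑ i, K i * c i ≤ m) {i : ι}
    (hi : K i ≠ 0) : c i = m := by
  have h1 : ∑ i, K i * c i = m + ∑ i, K i * (c i - m) := by
    calc ∑ i, K i * c i = ∑ i, (K i * m + K i * (c i - m)) := by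
          refine Finset.sum_congr rfl fun j _ => ?_
          by_cases hj : K j = 0
          · simp [hj]
          · rw [← mul_add, add_tsub_cancel_of_le (hc j hj)]
      _ = _ := by rw [Finset.sum_add_distrib, ← Finset.sum_mul, hK, one_mul]
  have h2 : ∑ i, K i * (c i - m) = 0 := by
    rw [h1] at h
    exact le_zero_iff.1 ((ENNReal.add_le_add_iff_left hm).1 (h.trans_eq (add_zero m).symm))
  have h3 := (Finset.sum_eq_zero_iff.1 h2) i (Finset.mem_univ i)
  rcases mul_eq_zero.1 h3 with h4 | h4
  · exact absurd h4 hi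
  · exact (tsub_eq_zero_iff_le.1 h4).antisymm (hc i hi)

section

variable {V X : Type*} [Fintype V] [EditableGraph X V] {𝒢 : Set X} {P : V → X → V → Prop}

/-! ### The iteration terminates -/

theorem exists_exitProb_ne_zero {w₀ w : V} {p : Option V} {G H : X}
    (h : Exits 𝒢 w₀ G p w H) : ∃ k, exitProb 𝒢 w₀ k G p w H ≠ 0 := by
  classical
  induction h with
  | @last G p w a b ha hb h =>
    subst h
    refine ⟨1, fun h0 => ?_⟩
    rw [exitProb, Finset.sum_eq_zero_iff] at h0
    have h1 := Finset.sum_eq_zero_iff.1 (h0 a (Finset.mem_univ a)) b (Finset.mem_univ b)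
    simp [unif_ne_zero.2 ha, unif_ne_zero.2 hb] at h1
  | @step G p w a b H ha hb h _ ih =>
    obtain ⟨k, hk⟩ := ih
    refine ⟨k + 1, fun h0 => ?_⟩
    rw [exitProb, Finset.sum_eq_zero_iff] at h0
    have h1 := Finset.sum_eq_zero_iff.1 (h0 a (Finset.mem_univ a)) b (Finset.mem_univ b)
    simp [unif_ne_zero.2 ha, unif_ne_zero.2 hb, h, hk] at h1

theorem IsSwapSystem.exists_iterProb_ne_zero (hS : IsSwapSystem 𝒢 P) {G H : X}
    (hG : G ∈ 𝒢) (hH : H ∈ 𝒢) (hne : G ≠ H) :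
    ∃ G' ∈ 𝒢, iterProb 𝒢 G G' ≠ 0 ∧ excess G' H < excess G H := by
  classical
  obtain ⟨c, w, hc, hc'⟩ := hS.exists_hasEdge_of_ne hG hH hne
  have hP : P w G w := hS.mem_iff.2 hG
  obtain ⟨G', hG', he, hlt⟩ := hS.exists_exits hH _ rfl hP hc hc' (p := none) (by simp)
  refine ⟨G', hG', ?_, hlt⟩
  obtain ⟨k, hk⟩ := exists_exitProb_ne_zero he
  have hw : w ∈ startSet 𝒢 G :=
    mem_startSet.2 ⟨c, mem_inNbrs.2 ⟨hc, hS.not_known hP hH fun h => hc' (h.1 hc)⟩⟩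
  rw [iterProb, if_pos ⟨w, hw⟩]
  intro h0
  have h1 := Finset.sum_eq_zero_iff.1 h0 w (Finset.mem_univ w)
  rcases mul_eq_zero.1 h1 with h2 | h2
  · exact unif_ne_zero.2 hw h2
  · exact hk (ENNReal.tsum_eq_zero.1 h2 k)

open Classical in
theorem sum_pass_le_one {w : V} {p : Option V} {G : X} {c : V → V → ℝ≥0∞} (hc : ∀ a b, c a b ≤ 1) :
    ∑ a, ∑ b, unif (inNbrsAvoid 𝒢 G p w) a * unif (nonOutNbrs 𝒢 G a) b * c a b ≤ 1 := by
  calc _ ≤ ∑ a, ∑ b, unif (inNbrsAvoid 𝒢 G p w) a * unif (nonOutNbrs 𝒢 G a) b :=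
        Finset.sum_le_sum fun a _ => Finset.sum_le_sum fun b _ =>
          mul_le_of_le_one_right' (hc a b)
    _ ≤ ∑ a, unif (inNbrsAvoid 𝒢 G p w) a := Finset.sum_le_sum fun a _ => by
        rw [← Finset.mul_sum]
        exact mul_le_of_le_one_right' (sum_unif_le_one _)
    _ ≤ 1 := sum_unif_le_one _

open Classical in
theorem IsSwapSystem.sum_pass (hS : IsSwapSystem 𝒢 P) {w₀ w : V} {p : Option V} {G : X}
    (hG : P w₀ G w) (hne : (inNbrsAvoid 𝒢 G p w).Nonempty) :
    ∑ x : V × V, unif (inNbrsAvoid 𝒢 G p w) x.1 * unif (nonOutNbrs 𝒢 G x.1) x.2 = 1 := by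
  rw [Fintype.sum_prod_type, ← sum_unif hne]
  refine Finset.sum_congr rfl fun a _ => ?_
  by_cases ha : a ∈ inNbrsAvoid 𝒢 G p w
  · dsimp only
    rw [← Finset.mul_sum, sum_unif (hS.nonOutNbrs_nonempty hG
      (mem_inNbrs.2 (mem_inNbrsAvoid.1 ha).1)), mul_one]
  · simp [unif, ha]

variable [Fintype 𝒢]

/-- The probability that the loop stops and returns a graph in `𝒢`. -/
noncomputable def stopProb (𝒢 : Set X) [Fintype 𝒢] (w₀ : V) (G : X) (p : Option V) (w : V) :
    ℝ≥0∞ :=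
  ∑ H : 𝒢, ∑' k, exitProb 𝒢 w₀ k G p w H

open Classical in
-- First-pass decomposition: stopping probabilities are harmonic for the loop, with boundary value 1
-- when it closes up inside `𝒢`.
theorem stopProb_eq (w₀ : V) (G : X) (p : Option V) (w : V) :
    stopProb 𝒢 w₀ G p w =
      ∑ a, ∑ b, unif (inNbrsAvoid 𝒢 G p w) a * unif (nonOutNbrs 𝒢 G a) b *
        if b = w₀ then ∑ H : 𝒢, (if swapEdge G a w b = H then 1 else 0)
        else stopProb 𝒢 w₀ (swapEdge G a w b) (some a) b := by
  have h : ∀ H : 𝒢, ∑' k, exitProb 𝒢 w₀ k G p w H =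
      ∑ a, ∑ b, unif (inNbrsAvoid 𝒢 G p w) a * unif (nonOutNbrs 𝒢 G a) b *
        if b = w₀ then (if swapEdge G a w b = H then 1 else 0)
        else ∑' k, exitProb 𝒢 w₀ k (swapEdge G a w b) (some a) b H := by
    intro H
    -- Zero passes contribute nothing, so the series can be shifted by one.
    rw [tsum_eq_zero_add' ENNReal.summable, exitProb, zero_add]
    simp only [exitProb]
    rw [Summable.tsum_finsetSum fun _ _ => ENNReal.summable]
    refine Finset.sum_congr rfl fun a _ => ?_
    rw [Summable.tsum_finsetSum fun _ _ => ENNReal.summable]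
    refine Finset.sum_congr rfl fun b _ => ?_
    rw [ENNReal.tsum_mul_left]
    congr 1
    by_cases hb : b = w₀
    · simp only [hb, if_true]
      rw [tsum_eq_single 0 (by simp +contextual)]
      simp
    · simp only [hb, if_false]
  simp only [stopProb, h]
  rw [Finset.sum_comm]
  refine Finset.sum_congr rfl fun a _ => ?_
  rw [Finset.sum_comm]
  refine Finset.sum_congr rfl fun b _ => ?_
  rw [← Finset.mul_sum]
  congr 1
  split_ifs <;> rfl

theorem sum_ite_eq_coe_le_one (G : X) :
    open Classical in ∑ H : 𝒢, (if G = H then (1 : ℝ≥0∞) else 0) ≤ 1 := by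
  classical
  by_cases hG : G ∈ 𝒢
  · rw [Finset.sum_eq_single ⟨G, hG⟩] <;> simp
    exact fun a ha h h' => absurd h'.symm h
  · rw [Finset.sum_eq_zero]
    · exact bot_le
    · rintro ⟨H, hH⟩ -
      exact if_neg fun h : G = H => hG (h ▸ hH)

theorem sum_ite_eq_coe {G : X} (hG : G ∈ 𝒢) :
    open Classical in ∑ H : 𝒢, (if G = H then (1 : ℝ≥0∞) else 0) = 1 := by
  classical
  rw [Finset.sum_eq_single ⟨G, hG⟩] <;> simp
  exact fun a ha h h' => absurd h'.symm h

/-- Exits after different numbers of passes, or to different graphs, are disjoint events. The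
induction runs over all states, since the first pass changes the state. -/
theorem sum_range_exitProb_le_one (w₀ : V) (n : ℕ) : ∀ (G : X) (p : Option V) (w : V),
    ∑ k ∈ Finset.range n, ∑ H : 𝒢, exitProb 𝒢 w₀ k G p w H ≤ 1 := by
  classical
  induction n with
  | zero => simp
  | succ n ih =>
    intro G p w
    rw [Finset.sum_range_succ']
    simp only [exitProb, Finset.sum_const_zero, add_zero]
    have hcomm : ∀ (K : V → V → ℝ≥0∞) (c : ℕ → 𝒢 → V → V → ℝ≥0∞),
        ∑ k ∈ Finset.range n, ∑ H, ∑ a, ∑ b, K a b * c k H a b =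
          ∑ a, ∑ b, K a b * ∑ k ∈ Finset.range n, ∑ H, c k H a b := by
      intro K c
      simp only [Finset.mul_sum]
      calc _ = ∑ k ∈ Finset.range n, ∑ a, ∑ b, ∑ H, K a b * c k H a b := by
            refine Finset.sum_congr rfl fun k _ => ?_
            rw [Finset.sum_comm]
            exact Finset.sum_congr rfl fun a _ => Finset.sum_comm
        _ = _ := by
            rw [Finset.sum_comm]
            exact Finset.sum_congr rfl fun a _ => Finset.sum_comm
    rw [hcomm]
    refine sum_pass_le_one fun a b => ?_
    by_cases hb : b = w₀
    · simp only [hb, if_true]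
      rw [Finset.sum_comm]
      refine le_trans (Finset.sum_le_sum fun H _ => ?_) (sum_ite_eq_coe_le_one (swapEdge G a w w₀))
      by_cases hH : swapEdge G a w w₀ = H
      · simp only [hH, and_true, if_true, Finset.sum_ite_eq']
        split_ifs <;> simp
      · simp [hH]
    · simp only [hb, if_false]
      exact ih _ _ _

theorem stopProb_le_one (w₀ : V) (G : X) (p : Option V) (w : V) : stopProb 𝒢 w₀ G p w ≤ 1 := by
  rw [stopProb, ← Summable.tsum_finsetSum fun _ _ => ENNReal.summable]
  exact ENNReal.tsum_le_of_sum_range_le fun n => sum_range_exitProb_le_one w₀ n G p w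

/-- If `m < 1` bounds the stopping probability below and is attained at some state, then the loop
cannot stop from there. -/
theorem IsSwapSystem.not_exits (hS : IsSwapSystem 𝒢 P) {w₀ : V} {m : ℝ≥0∞} (hm : m < 1)
    (hmin : ∀ {G a w}, IsState 𝒢 P w₀ G (some a) w → m ≤ stopProb 𝒢 w₀ G (some a) w)
    {G H : X} {p : Option V} {w : V} (he : Exits 𝒢 w₀ G p w H) (hs : IsState 𝒢 P w₀ G p w)
    (h : stopProb 𝒢 w₀ G p w ≤ m) : False := by
  classical
  -- Minimum principle: a mean of values at least `m` that does not exceed `m` forces `m` at every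
  -- successor. A closing pass would have value 1, so none is possible, and minimality propagates
  -- along the supposed exit path.
  have key : ∀ {G : X} {p : Option V} {w : V}, IsState 𝒢 P w₀ G p w →
      stopProb 𝒢 w₀ G p w ≤ m → ∀ {a b}, a ∈ inNbrsAvoid 𝒢 G p w → b ∈ nonOutNbrs 𝒢 G a →
      b ≠ w₀ ∧ stopProb 𝒢 w₀ (swapEdge G a w b) (some a) b = m := by
    intro G p w hs h a b ha hb
    have hmem : ∀ {x : V × V},
        unif (inNbrsAvoid 𝒢 G p w) x.1 * unif (nonOutNbrs 𝒢 G x.1) x.2 ≠ 0 ↔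
        x.1 ∈ inNbrsAvoid 𝒢 G p w ∧ x.2 ∈ nonOutNbrs 𝒢 G x.1 := by
      intro x
      rw [mul_ne_zero_iff, unif_ne_zero, unif_ne_zero]
    rw [stopProb_eq, ← Fintype.sum_prod_type'] at h
    have h1 := eq_of_sum_mul_le (i := (a, b)) hm.ne_top (hS.sum_pass hs.1 ⟨a, ha⟩) ?_ h
      (hmem.2 ⟨ha, hb⟩)
    · by_cases hbw : b = w₀
      · rw [if_pos hbw, sum_ite_eq_coe
          (hS.swap_mem hs.1 (mem_inNbrs.2 (mem_inNbrsAvoid.1 ha).1) hb hbw)] at h1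
        exact absurd h1 hm.ne'
      · rw [if_neg hbw] at h1
        exact ⟨hbw, h1⟩
    · rintro ⟨a, b⟩ hx
      obtain ⟨ha, hb⟩ := hmem.1 hx
      have ha' := mem_inNbrs.2 (mem_inNbrsAvoid.1 ha).1
      dsimp only at hb ⊢
      split_ifs with hbw
      · rw [sum_ite_eq_coe (hS.swap_mem hs.1 ha' hb hbw)]
        exact hm.le
      · exact hmin (hS.isState_swap hs.1 ha' hb hbw)
  induction he with
  | last ha hb hbw => exact (key hs h ha hb).1 hbw
  | step ha hb hbw _ ih =>
    exact ih (hS.isState_swap hs.1 (mem_inNbrs.2 (mem_inNbrsAvoid.1 ha).1) hb hbw)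
      (key hs h ha hb).2.le

theorem IsSwapSystem.stopProb_eq_one [Finite X] (hS : IsSwapSystem 𝒢 P) {w₀ w a : V} {G : X}
    (hs : IsState 𝒢 P w₀ G (some a) w) : stopProb 𝒢 w₀ G (some a) w = 1 := by
  refine (stopProb_le_one w₀ G (some a) w).antisymm ?_
  -- Finiteness of the set of loop states gives a state where the stopping probability is minimal;
  -- it too has a way out.
  obtain ⟨⟨G₁, a₁, w₁⟩, h₁, hmin⟩ := Set.exists_min_image
    {x : X × V × V | IsState 𝒢 P w₀ x.1 (some x.2.1) x.2.2}
    (fun x => stopProb 𝒢 w₀ x.1 (some x.2.1) x.2.2) (Set.toFinite _) ⟨(G, a, w), hs⟩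
  refine le_trans ?_ (hmin (G, a, w) hs)
  by_contra! hlt
  obtain ⟨H, hH⟩ := hS.exists_exits_of_isState h₁
  exact hS.not_exits hlt (fun {G a w} h => hmin (G, a, w) h) hH h₁ le_rfl

theorem IsSwapSystem.stopProb_start [Finite X] (hS : IsSwapSystem 𝒢 P) {w₀ : V} {G : X}
    (hG : G ∈ 𝒢) (hw : w₀ ∈ startSet 𝒢 G) : stopProb 𝒢 w₀ G none w₀ = 1 := by
  classical
  have hP : P w₀ G w₀ := hS.mem_iff.2 hG
  obtain ⟨c, hc⟩ := mem_startSet.1 hw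
  rw [stopProb_eq, ← Fintype.sum_prod_type']
  refine Eq.trans ?_ (hS.sum_pass hP
    (p := none) ⟨c, mem_inNbrsAvoid.2 ⟨mem_inNbrs.1 hc, by simp⟩⟩)
  refine Finset.sum_congr rfl fun x _ => ?_
  by_cases ha : x.1 ∈ inNbrsAvoid 𝒢 G none w₀
  · by_cases hb : x.2 ∈ nonOutNbrs 𝒢 G x.1
    · have ha' := mem_inNbrs.2 (mem_inNbrsAvoid.1 ha).1
      split_ifs with hbw
      · rw [sum_ite_eq_coe (hS.swap_mem hP ha' hb hbw), mul_one]
      · rw [hS.stopProb_eq_one (hS.isState_swap hP ha' hb hbw), mul_one]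
    · simp [unif, hb]
  · simp [unif, ha]

theorem IsSwapSystem.sum_iterProb [Finite X] (hS : IsSwapSystem 𝒢 P) {G : X} (hG : G ∈ 𝒢) :
    ∑ H : 𝒢, iterProb 𝒢 G H = 1 := by
  classical
  by_cases hne : (startSet 𝒢 G).Nonempty
  · simp only [iterProb, if_pos hne]
    rw [Finset.sum_comm, ← sum_unif hne]
    refine Finset.sum_congr rfl fun w₀ _ => ?_
    rw [← Finset.mul_sum]
    by_cases hw : w₀ ∈ startSet 𝒢 G
    · have := hS.stopProb_start hG hw
      rw [stopProb] at this
      rw [this, mul_one]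
    · simp [unif, hw]
  · simp only [iterProb, if_neg hne]
    exact sum_ite_eq_coe hG

theorem IsSwapSystem.iterProb_ne_top [Finite X] (hS : IsSwapSystem 𝒢 P) {G H : X} (hG : G ∈ 𝒢)
    (hH : H ∈ 𝒢) : iterProb 𝒢 G H ≠ ∞ := by
  have h := Finset.single_le_sum (f := fun H : 𝒢 => iterProb 𝒢 G H) (fun _ _ => bot_le)
    (Finset.mem_univ ⟨H, hH⟩)
  rw [hS.sum_iterProb hG] at h
  exact (h.trans_lt ENNReal.one_lt_top).ne

/-! ### Ergodicity -/

theorem IsSwapSystem.exists_pow_transition_pos [Finite X] [DecidableEq 𝒢]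
    (hS : IsSwapSystem 𝒢 P) (H : 𝒢) (n : ℕ) :
    ∀ G : 𝒢, excess (G : X) (H : X) = n → ∃ k, 0 < (transition 𝒢 ^ k) G H := by
  have hnn : ∀ k (G H : 𝒢), 0 ≤ (transition 𝒢 ^ k) G H := by
    intro k
    induction k with
    | zero =>
      intro G H
      rw [pow_zero, Matrix.one_apply]
      split_ifs <;> norm_num
    | succ k ih =>
      intro G H
      rw [pow_succ, Matrix.mul_apply]
      exact Finset.sum_nonneg fun K _ => mul_nonneg (ih G K) ENNReal.toReal_nonneg
  induction n using Nat.strong_induction_on with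
  | _ n ih =>
    intro G hn
    by_cases hne : G = H
    · exact ⟨0, by simp [hne]⟩
    · obtain ⟨G', hG', h0, hlt⟩ := hS.exists_iterProb_ne_zero G.2 H.2 (Subtype.coe_ne_coe.2 hne)
      obtain ⟨k, hk⟩ := ih _ (hn ▸ hlt) ⟨G', hG'⟩ rfl
      refine ⟨k + 1, ?_⟩
      rw [pow_succ', Matrix.mul_apply]
      exact Finset.sum_pos' (fun K _ => mul_nonneg ENNReal.toReal_nonneg (hnn k K H))
        ⟨⟨G', hG'⟩, Finset.mem_univ _,
          mul_pos (ENNReal.toReal_pos h0 (hS.iterProb_ne_top G.2 hG')) hk⟩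

theorem IsSwapSystem.isErgodicChain [Finite X] [DecidableEq 𝒢] (hS : IsSwapSystem 𝒢 P)
    (hne : 𝒢.Nonempty) : IsErgodicChain (transition 𝒢) (uniformDist 𝒢) := by
  have : Nonempty 𝒢 := hne.to_subtype
  have := Fintype.ofFinite X
  refine isErgodicChain_uniformDist ?_ ?_ fun G H => hS.exists_pow_transition_pos H _ G rfl
  · refine Matrix.mem_rowStochastic_iff_sum.2 ⟨fun G H => ENNReal.toReal_nonneg, fun G => ?_⟩
    simp only [transition, Matrix.of_apply]
    rw [← ENNReal.toReal_sum fun H _ => hS.iterProb_ne_top G.2 H.2, hS.sum_iterProb G.2,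
      ENNReal.toReal_one]
  · intro G H
    simp only [transition, Matrix.of_apply, hS.iterProb_comm G.2 H.2]

end

/-! ### Directed graphs -/

section Directed

variable {V : Type*}

theorem digraph_hasEdge_swapEdge (G : Digraph V) (a w b x y : V) :
    HasEdge (swapEdge G a w b) x y ↔
      (HasEdge G x y ∧ ¬ (x = a ∧ y = w)) ∨ (x = a ∧ y = b) := Iff.rfl

theorem digraph_outDeg_swapEdge [Finite V] {G : Digraph V} {a w b : V} (hw : HasEdge G a w)
    (hb : ¬ HasEdge G a b) (v : V) : (swapEdge G a w b).outDeg v = G.outDeg v := by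
  by_cases hv : v = a
  · subst hv
    have : {u | (swapEdge G v w b).Adj v u} = insert b ({u | G.Adj v u} \ {w}) := by
      ext u
      change HasEdge (swapEdge G v w b) v u ↔ u = b ∨ (HasEdge G v u ∧ u ≠ w)
      rw [digraph_hasEdge_swapEdge]
      tauto
    rw [Digraph.outDeg, this]
    exact Set.ncard_exchange hb hw
  · have : {u | (swapEdge G a w b).Adj v u} = {u | G.Adj v u} := by
      ext u
      change HasEdge (swapEdge G a w b) v u ↔ HasEdge G v u
      rw [digraph_hasEdge_swapEdge]
      tauto
    rw [Digraph.outDeg, this, Digraph.outDeg]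

open Classical in
theorem digraph_inDeg_swapEdge [Finite V] {G : Digraph V} {a w b : V} (hw : HasEdge G a w)
    (hb : ¬ HasEdge G a b) (v : V) :
    (swapEdge G a w b).inDeg v + (if v = w then 1 else 0) =
      G.inDeg v + if v = b then 1 else 0 := by
  have hwb : w ≠ b := fun h => hb (h ▸ hw)
  simp only [Digraph.inDeg]
  by_cases hvw : v = w
  · subst hvw
    have : {u | (swapEdge G a v b).Adj u v} = {u | G.Adj u v} \ {a} := by
      ext u
      change HasEdge (swapEdge G a v b) u v ↔ HasEdge G u v ∧ u ≠ a
      rw [digraph_hasEdge_swapEdge]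
      tauto
    rw [if_pos rfl, if_neg hwb, this]
    exact Set.ncard_sdiff_singleton_add_one hw
  · by_cases hvb : v = b
    · subst hvb
      have : {u | (swapEdge G a w v).Adj u v} = insert a {u | G.Adj u v} := by
        ext u
        change HasEdge (swapEdge G a w v) u v ↔ u = a ∨ HasEdge G u v
        rw [digraph_hasEdge_swapEdge]
        tauto
      rw [if_pos rfl, if_neg hvw, this, add_zero]
      exact Set.ncard_insert_of_notMem hb
    · have : {u | (swapEdge G a w b).Adj u v} = {u | G.Adj u v} := by
        ext u
        change HasEdge (swapEdge G a w b) u v ↔ HasEdge G u v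
        rw [digraph_hasEdge_swapEdge]
        tauto
      rw [if_neg hvw, if_neg hvb, this]

open Classical in
/-- `G` has the degrees of `G₀`, except for one missing edge into `w₀` and one additional edge into
`w`, and it agrees with `G₀` where all the graphs of the class do. -/
def DirectedNear (G₀ : Digraph V) (F : Set (V × V)) (w₀ : V) (G : Digraph V) (w : V) : Prop :=
  (∀ v, G.outDeg v = G₀.outDeg v) ∧
  (∀ v, G.inDeg v + (if v = w₀ then 1 else 0) = G₀.inDeg v + if v = w then 1 else 0) ∧
  ∀ u v, Known (directedClass G₀ F) u v → (HasEdge G u v ↔ HasEdge G₀ u v)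

/-- Preserving the known pairs therefore preserves the constraint on `F`, so the invariant need not
mention `F` separately. -/
theorem known_directedClass {G₀ : Digraph V} {F : Set (V × V)} {u v : V} (h : (u, v) ∈ F) :
    Known (directedClass G₀ F) u v := by
  have h1 : ∀ G ∈ directedClass G₀ F, (HasEdge G u v ↔ HasEdge G₀ u v) := by
    intro G hG
    have := Set.ext_iff.1 hG.2 (u, v)
    simpa [h, Digraph.edges, HasEdge] using this
  by_cases h2 : HasEdge G₀ u v
  · exact Or.inl fun G hG => (h1 G hG).2 h2
  · exact Or.inr fun G hG => fun h => h2 ((h1 G hG).1 h)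

theorem self_mem_directedClass (G₀ : Digraph V) (F : Set (V × V)) : G₀ ∈ directedClass G₀ F :=
  ⟨fun _ => ⟨rfl, rfl⟩, rfl⟩

theorem isSwapSystem_directed [Finite V] (G₀ : Digraph V) (F : Set (V × V)) :
    IsSwapSystem (directedClass G₀ F) (DirectedNear G₀ F) where
  ext h := Digraph.ext (funext fun u => funext fun v => propext (h u v))
  mem_iff := by
    intro w₀ G
    constructor
    · rintro ⟨h1, h2, h3⟩
      refine ⟨fun v => ⟨Nat.add_right_cancel (h2 v), h1 v⟩, ?_⟩
      ext ⟨u, v⟩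
      exact and_congr_left fun h => h3 u v (known_directedClass h)
    · intro h
      exact ⟨fun v => (h.1 v).2, fun v => by rw [(h.1 v).1],
        fun u v hk => hk.hasEdge_iff h (self_mem_directedClass G₀ F)⟩
  hasEdge_iff hG hH hk :=
    (hG.2.2 _ _ hk).trans (hk.hasEdge_iff (self_mem_directedClass G₀ F) hH)
  ncard_in := by
    intro w₀ G w H hG hH
    have h1 := hG.2.1 w
    rw [← (hH.1 w).1, if_pos rfl] at h1
    change G.inDeg w = H.inDeg w + _
    split_ifs at h1 ⊢ <;> omega
  ncard_out := by
    intro w₀ G w H a hG hH _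
    exact ((hG.1 a).trans (hH.1 a).2.symm).le
  swap := by
    intro w₀ G w a b hG hw hwk hb hbk
    refine ⟨fun v => (digraph_outDeg_swapEdge hw hb v).trans (hG.1 v), fun v => ?_,
      fun u v hk => ?_⟩
    · have h1 := digraph_inDeg_swapEdge hw hb v
      have h2 := hG.2.1 v
      omega
    · rw [digraph_hasEdge_swapEdge, ← hG.2.2 u v hk]
      have h1 : ¬ (u = a ∧ v = w) := by rintro ⟨rfl, rfl⟩; exact hwk hk
      have h2 : ¬ (u = a ∧ v = b) := by rintro ⟨rfl, rfl⟩; exact hbk hk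
      tauto
  hasEdge_swap := by
    intro G w a b y hw hb _
    rw [digraph_hasEdge_swapEdge]
    tauto
  swap_swap := by
    intro G w a b hw hb _
    refine Digraph.ext (funext fun u => funext fun v => propext ?_)
    change HasEdge (swapEdge (swapEdge G a w b) a b w) u v ↔ HasEdge G u v
    rw [digraph_hasEdge_swapEdge, digraph_hasEdge_swapEdge]
    have h1 : u = a ∧ v = w → HasEdge G u v := by rintro ⟨rfl, rfl⟩; exact hw
    have h2 : u = a ∧ v = b → ¬ HasEdge G u v := by rintro ⟨rfl, rfl⟩; exact hb
    tauto
  of_hasEdge_swap := by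
    intro G H w a b x y hH h h'
    rcases (digraph_hasEdge_swapEdge G a w b x y).1 h with h | ⟨rfl, rfl⟩
    · exact h.1
    · exact absurd hH h'

end Directed

/-! ### Undirected graphs -/

section Undirected

variable {V : Type*}

theorem simpleGraph_hasEdge_swapEdge (G : SimpleGraph V) (a w b x y : V) :
    HasEdge (swapEdge G a w b) x y ↔
      (HasEdge G x y ∧ s(x, y) ≠ s(a, w)) ∨ (s(x, y) = s(a, b) ∧ x ≠ y) := by
  change ((G.deleteEdges {s(a, w)}) ⊔ SimpleGraph.edge a b).Adj x y ↔ _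
  rw [SimpleGraph.sup_adj, SimpleGraph.deleteEdges_adj, SimpleGraph.edge_adj, Sym2.eq_iff]
  rfl

open Classical in
theorem simpleGraph_degree_eq [Fintype V] (G : SimpleGraph V) (v : V) :
    G.degree v = {u | HasEdge G v u}.ncard := by
  rw [← SimpleGraph.card_neighborSet_eq_degree, ← Nat.card_eq_fintype_card]
  rfl

theorem simpleGraph_hasEdge_comm (G : SimpleGraph V) (u v : V) : HasEdge G u v ↔ HasEdge G v u :=
  G.adj_comm u v

theorem simpleGraph_hasEdge_ne {G : SimpleGraph V} {u v : V} (h : HasEdge G u v) : u ≠ v :=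
  SimpleGraph.Adj.ne h

theorem simpleGraph_known_comm {𝒢 : Set (SimpleGraph V)} {u v : V} :
    Known 𝒢 u v ↔ Known 𝒢 v u := by
  simp only [Known, fun G : SimpleGraph V => simpleGraph_hasEdge_comm G u v]

theorem simpleGraph_ne_of_not_known {𝒢 : Set (SimpleGraph V)} {u v : V} (h : ¬ Known 𝒢 u v) :
    u ≠ v := by
  rintro rfl
  exact h (Or.inr fun G _ => G.irrefl)

open Classical in
theorem simpleGraph_ncard_swapEdge [Finite V] {G : SimpleGraph V} {a w b : V} (hw : HasEdge G a w)
    (hb : ¬ HasEdge G a b) (hab : a ≠ b) (v : V) :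
    {u | HasEdge (swapEdge G a w b) v u}.ncard + (if v = w then 1 else 0) =
      {u | HasEdge G v u}.ncard + if v = b then 1 else 0 := by
  have hwb : w ≠ b := fun h => hb (h ▸ hw)
  have haw : a ≠ w := simpleGraph_hasEdge_ne hw
  have hb' : ¬ HasEdge G b a := fun h => hb ((simpleGraph_hasEdge_comm _ _ _).1 h)
  have hw' : HasEdge G w a := (simpleGraph_hasEdge_comm _ _ _).1 hw
  by_cases hva : v = a
  · subst hva
    have : {u | HasEdge (swapEdge G v w b) v u} = insert b ({u | HasEdge G v u} \ {w}) := by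
      ext u
      change HasEdge (swapEdge G v w b) v u ↔ u = b ∨ (HasEdge G v u ∧ u ≠ w)
      rw [simpleGraph_hasEdge_swapEdge, Ne, Sym2.eq_iff, Sym2.eq_iff]
      grind
    rw [if_neg haw, if_neg hab, this]
    exact Set.ncard_exchange hb hw
  by_cases hvw : v = w
  · subst hvw
    have : {u | HasEdge (swapEdge G a v b) v u} = {u | HasEdge G v u} \ {a} := by
      ext u
      change HasEdge (swapEdge G a v b) v u ↔ HasEdge G v u ∧ u ≠ a
      rw [simpleGraph_hasEdge_swapEdge, Ne, Sym2.eq_iff, Sym2.eq_iff]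
      grind
    rw [if_pos rfl, if_neg hwb, this]
    exact Set.ncard_sdiff_singleton_add_one hw'
  by_cases hvb : v = b
  · subst hvb
    have : {u | HasEdge (swapEdge G a w v) v u} = insert a {u | HasEdge G v u} := by
      ext u
      change HasEdge (swapEdge G a w v) v u ↔ u = a ∨ HasEdge G v u
      rw [simpleGraph_hasEdge_swapEdge, Ne, Sym2.eq_iff, Sym2.eq_iff]
      grind
    rw [if_pos rfl, if_neg hvw, this, add_zero]
    exact Set.ncard_insert_of_notMem hb'
  have : {u | HasEdge (swapEdge G a w b) v u} = {u | HasEdge G v u} := by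
    ext u
    change HasEdge (swapEdge G a w b) v u ↔ HasEdge G v u
    rw [simpleGraph_hasEdge_swapEdge, Ne, Sym2.eq_iff, Sym2.eq_iff]
    grind
  rw [if_neg hvw, if_neg hvb, this]

variable [Fintype V]

open Classical in
/-- `G` has the degrees of `G₀`, except for one missing edge at `w₀` and one additional edge at
`w`, and it agrees with `G₀` where all the graphs of the class do. -/
def UndirectedNear (G₀ : SimpleGraph V) (F : Set (Sym2 V)) (w₀ : V) (G : SimpleGraph V) (w : V) :
    Prop :=
  (∀ v, {u | HasEdge G v u}.ncard + (if v = w₀ then 1 else 0) =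
    {u | HasEdge G₀ v u}.ncard + if v = w then 1 else 0) ∧
  ∀ u v, Known (undirectedClass G₀ F) u v → (HasEdge G u v ↔ HasEdge G₀ u v)

theorem known_undirectedClass {G₀ : SimpleGraph V} {F : Set (Sym2 V)} {u v : V}
    (h : s(u, v) ∈ F) : Known (undirectedClass G₀ F) u v := by
  have h1 : ∀ G ∈ undirectedClass G₀ F, (HasEdge G u v ↔ HasEdge G₀ u v) := by
    intro G hG
    have := Set.ext_iff.1 hG.2 s(u, v)
    simpa [h, HasEdge] using this
  by_cases h2 : HasEdge G₀ u v
  · exact Or.inl fun G hG => (h1 G hG).2 h2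
  · exact Or.inr fun G hG => fun h => h2 ((h1 G hG).1 h)

theorem self_mem_undirectedClass (G₀ : SimpleGraph V) (F : Set (Sym2 V)) :
    G₀ ∈ undirectedClass G₀ F := ⟨fun _ => rfl, rfl⟩

theorem ncard_of_mem_undirectedClass {G₀ G : SimpleGraph V} {F : Set (Sym2 V)}
    (hG : G ∈ undirectedClass G₀ F) (v : V) :
    {u | HasEdge G v u}.ncard = {u | HasEdge G₀ v u}.ncard := by
  classical
  have := hG.1 v
  rwa [simpleGraph_degree_eq, simpleGraph_degree_eq] at this

theorem isSwapSystem_undirected (G₀ : SimpleGraph V) (F : Set (Sym2 V)) :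
    IsSwapSystem (undirectedClass G₀ F) (UndirectedNear G₀ F) where
  ext h := SimpleGraph.ext (funext fun u => funext fun v => propext (h u v))
  mem_iff := by
    classical
    intro w₀ G
    constructor
    · rintro ⟨h1, h2⟩
      refine ⟨fun v => ?_, ?_⟩
      · rw [simpleGraph_degree_eq, simpleGraph_degree_eq]
        exact Nat.add_right_cancel (h1 v)
      · ext e
        induction e with
        | _ u v => exact and_congr_left fun h => h2 u v (known_undirectedClass h)
    · intro h
      exact ⟨fun v => by rw [ncard_of_mem_undirectedClass h],
        fun u v hk => hk.hasEdge_iff h (self_mem_undirectedClass G₀ F)⟩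
  hasEdge_iff hG hH hk :=
    (hG.2 _ _ hk).trans (hk.hasEdge_iff (self_mem_undirectedClass G₀ F) hH)
  ncard_in := by
    intro w₀ G w H hG hH
    have h1 := hG.1 w
    rw [← ncard_of_mem_undirectedClass hH, if_pos rfl] at h1
    simp only [fun (G : SimpleGraph V) v => simpleGraph_hasEdge_comm G v w]
    split_ifs at h1 ⊢ <;> omega
  ncard_out := by
    intro w₀ G w H a hG hH h
    have h1 := hG.1 a
    -- Without loops `a ≠ w`, so `a` has no surplus. It may equal `w₀`, where an edge is missing;
    -- hence only an inequality.
    rw [← ncard_of_mem_undirectedClass hH, if_neg (simpleGraph_hasEdge_ne h)] at h1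
    omega
  swap := by
    intro w₀ G w a b hG hw hwk hb hbk
    refine ⟨fun v => ?_, fun u v hk => ?_⟩
    · have h1 := simpleGraph_ncard_swapEdge hw hb (simpleGraph_ne_of_not_known hbk) v
      have h2 := hG.1 v
      omega
    · rw [simpleGraph_hasEdge_swapEdge, ← hG.2 u v hk]
      have h1 : s(u, v) ≠ s(a, w) := by
        rw [Ne, Sym2.eq_iff]
        rintro (⟨rfl, rfl⟩ | ⟨rfl, rfl⟩)
        · exact hwk hk
        · exact hwk (simpleGraph_known_comm.1 hk)
      have h2 : s(u, v) ≠ s(a, b) := by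
        rw [Ne, Sym2.eq_iff]
        rintro (⟨rfl, rfl⟩ | ⟨rfl, rfl⟩)
        · exact hbk hk
        · exact hbk (simpleGraph_known_comm.1 hk)
      tauto
  hasEdge_swap := by
    intro G w a b y hw hb hbk
    have hab := simpleGraph_ne_of_not_known hbk
    have haw := simpleGraph_hasEdge_ne hw
    rw [simpleGraph_hasEdge_swapEdge, Ne, Sym2.eq_iff, Sym2.eq_iff]
    grind
  swap_swap := by
    intro G w a b hw hb hbk
    have hab := simpleGraph_ne_of_not_known hbk
    have haw := simpleGraph_hasEdge_ne hw
    have hb' : ¬ HasEdge G b a := fun h => hb ((simpleGraph_hasEdge_comm _ _ _).1 h)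
    have hw' : HasEdge G w a := (simpleGraph_hasEdge_comm _ _ _).1 hw
    refine SimpleGraph.ext (funext fun u => funext fun v => propext ?_)
    change HasEdge (swapEdge (swapEdge G a w b) a b w) u v ↔ HasEdge G u v
    simp only [simpleGraph_hasEdge_swapEdge, Ne, Sym2.eq_iff]
    grind
  of_hasEdge_swap := by
    intro G H w a b x y hH h h'
    rcases (simpleGraph_hasEdge_swapEdge G a w b x y).1 h with h | ⟨h, -⟩
    · exact h.1
    · rcases Sym2.eq_iff.1 h with ⟨rfl, rfl⟩ | ⟨rfl, rfl⟩
      · exact absurd hH h'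
      · exact absurd ((simpleGraph_hasEdge_comm _ _ _).1 hH) h'

end Undirected

end UGS

open Classical in
theorem proposition2 {V : Type*} [Fintype V] :
    (∀ (G₀ : Digraph V) (F : Set (V × V)),
      IsErgodicChain (UGS.transition (directedClass G₀ F)) (uniformDist (directedClass G₀ F))) ∧
    (∀ (G₀ : SimpleGraph V) (F : Set (Sym2 V)),
      IsErgodicChain (UGS.transition (undirectedClass G₀ F))
        (uniformDist (undirectedClass G₀ F))) :=
  ⟨fun G₀ F => (UGS.isSwapSystem_directed G₀ F).isErgodicChain
      ⟨G₀, UGS.self_mem_directedClass G₀ F⟩,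
    fun G₀ F => (UGS.isSwapSystem_undirected G₀ F).isErgodicChain
      ⟨G₀, UGS.self_mem_undirectedClass G₀ F⟩⟩
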